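/- Let $(X,d)$ be a complete geodesic metric space with a locally finite Borel measure $\mu$ whose support is $X$. Assume that $\mu$ is doubling, i.e. $\mu(B(x,2r))\le C_d\,\mu(B(x,r))$ for all $x\in X$, $r>0$, and that $(X,d,\mu)$ supports a $2$-Poincaré inequality: there is a constant $C_P$ such that for every locally integrable $u$, every upper gradient $g$ of $u$ and every ball $B=B(x,r)$, $$\frac1{\mu(B)}\int_B|u-u_B|\,d\mu\le C_P\,r\Big(\frac1{\mu(B)}\int_B g^2\,d\mu\Big)^{1/2},\qquad u_B:=\frac1{\mu(B)}\int_B u\,d\mu .$$ Here a Borel function $g:X\to[0,\infty]$ is an upper gradient of $u:X\to\mathbb R$ if $|u(y)-u(x)|\le\int_\gamma g\,ds$ for every compact rectifiable curve $\gamma$ with end points $x,y$. Let $N^{1,2}(X)$ be the space of functions $u:X\to\mathbb R$ in $L^2(\mu)$ that have an upper gradient in $L^2(\mu)$, with norm $\|u\|_{N^{1,2}}=\big(\int_X u^2\,d\mu+\inf_g\int_X g^2\,d\mu\big)^{1/2}$, the infimum being over all upper gradients $g$ of $u$. For every $r>0$ fix a set $X_r\subset X$ with $d(\bar x,\bar y)\ge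 r$ for distinct $\bar x,\bar y\in X_r$ and $X=\bigcup_{\bar x\in X_r}B(\bar x,r)$. Write $\bar x\sim\bar y$ if $\bar x\ne\bar y$ are points of $X_r$ with $B(\bar x,2r)\cap B(\bar y,2r)\neq\emptyset$, put $u_r(\bar x)=\frac1{\mu(B(\bar x,r/4))}\int_{B(\bar x,r/4)}u\,d\mu$, and for $u,v\in N^{1,2}(X)$ define $$\mathcal E_r(u,v)=\sum_{\bar x\in X_r}\sum_{\bar y\sim\bar x}\frac{[u_r(\bar y)-u_r(\bar x)]\,[v_r(\bar y)-v_r(\bar x)]}{r^2}\,\mu(B(\bar x,2r)),\qquad \mathcal E_r[u]=\mathcal E_r(u,u).$$ These sums converge absolutely for all $r>0$ and $u,v\in N^{1,2}(X)$. Let $r_k>0$, $r_k\to0$, and suppose that the energies $\mathcal E_{r_k}[\cdot]$ $\Gamma$-converge on $N^{1,2}(X)$ to a functional $\mathcal E[\cdot]:N^{1,2}(X)\to[-\infty,\infty]$, i.e. (i) $\mathcal E[u]\le\liminf_k\mathcal E_{r_k}[u_k]$ whenever $u_k\to u$ in $N^{1,2}(X)$, and (ii) for each $u\in N^{1,2}(X)$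 there are $u_k\to u$ in $N^{1,2}(X)$ with $\limsup_k\mathcal E_{r_k}[u_k]\le\mathcal E[u]$. Then $\mathcal E[u]=\mathcal E(u,u)$ for a (necessarily unique) real-valued symmetric bilinear form $\mathcal E(\cdot,\cdot)$ on $N^{1,2}(X)$, and: 1. $\mathcal E$ is local: $\mathcal E(u,v)=0$ whenever $u,v\in N^{1,2}(X)$ have disjoint supports, where the support of $u$ is the set of points all of whose neighborhoods meet $\{u\neq0\}$ in a set of positive measure (a subset of the closure of $\{u\ne0\}$); 2. $\mathcal E[u]=\lim_{k\to\infty}\mathcal E_{r_k}[u]$ for every $u\in N^{1,2}(X)$, so the constant sequence is a recovery sequence. -/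

import Mathlib

open MeasureTheory Filter Topology Set
open scoped ENNReal NNReal

noncomputable section

namespace GraphForm

/-- Every two points are joined by a curve whose length is their distance, parametrized by
arc length. -/
def IsGeodesicSpace (X : Type*) [MetricSpace X] : Prop :=
  ∀ x y : X, ∃ γ : ℝ → X, γ 0 = x ∧ γ (dist x y) = y ∧
    ∀ s ∈ Icc 0 (dist x y), ∀ t ∈ Icc 0 (dist x y), dist (γ s) (γ t) = |s - t|

/-- The doubling property of a measure, at all centers and all scales. -/
def IsDoubling {X : Type*} [MetricSpace X] [MeasurableSpace X] (μ : Measure X) : Prop :=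
  ∃ C : ℝ≥0, ∀ (x : X) (r : ℝ), 0 < r →
    μ (Metric.ball x (2 * r)) ≤ C * μ (Metric.ball x r)

/-- The line integral `∫_γ g ds` of `g` over the curve `γ : [a, b] → X`: the integral of `g` along
the arc length parametrization of `γ`, over `[0, length γ]`. -/
def curveIntegral {X : Type*} [MetricSpace X] (g : X → ℝ≥0∞) (γ : ℝ → X) (a b : ℝ) : ℝ≥0∞ :=
  ∫⁻ t in Icc 0 (eVariationOn γ (Icc a b)).toReal, g (naturalParameterization γ (Icc a b) a t)

/-- `g` is an upper gradient of `u`: it is Borel, and the upper gradient inequality holds along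
every compact rectifiable curve (for constant curves the inequality says `0 ≤ 0`). -/
def IsUpperGradient {X : Type*} [MetricSpace X] [MeasurableSpace X]
    (u : X → ℝ) (g : X → ℝ≥0∞) : Prop :=
  Measurable g ∧ ∀ (a b : ℝ) (γ : ℝ → X), a ≤ b → ContinuousOn γ (Icc a b) →
    eVariationOn γ (Icc a b) ≠ ∞ →
    ENNReal.ofReal |u (γ b) - u (γ a)| ≤ curveIntegral g γ a b

/-- The `2`-Poincaré inequality (with the same ball on both sides) for all pairs of a locally
integrable function and one of its upper gradients. -/
def SupportsPoincare {X : Type*} [MetricSpace X] [MeasurableSpace X] (μ : Measure X) : Prop :=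
  ∃ C : ℝ≥0, ∀ (u : X → ℝ) (g : X → ℝ≥0∞), LocallyIntegrable u μ → IsUpperGradient u g →
    ∀ (x : X) (r : ℝ), 0 < r →
      ⨍⁻ y in Metric.ball x r, ENNReal.ofReal |u y - ⨍ z in Metric.ball x r, u z ∂μ| ∂μ ≤
        C * ENNReal.ofReal r * (⨍⁻ y in Metric.ball x r, g y ^ 2 ∂μ) ^ (1 / 2 : ℝ)

theorem IsUpperGradient.zero {X : Type*} [MetricSpace X] [MeasurableSpace X] :
    IsUpperGradient (0 : X → ℝ) 0 :=
  ⟨measurable_zero, fun a b γ _ _ _ => by simp⟩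

theorem IsUpperGradient.add {X : Type*} [MetricSpace X] [MeasurableSpace X]
    {u v : X → ℝ} {g h : X → ℝ≥0∞} (hu : IsUpperGradient u g) (hv : IsUpperGradient v h) :
    IsUpperGradient (u + v) (g + h) := by
  refine ⟨hu.1.add hv.1, fun a b γ hab hc hr => ?_⟩
  calc ENNReal.ofReal |(u + v) (γ b) - (u + v) (γ a)|
      ≤ ENNReal.ofReal (|u (γ b) - u (γ a)| + |v (γ b) - v (γ a)|) := by
        apply ENNReal.ofReal_le_ofReal
        have : (u + v) (γ b) - (u + v) (γ a) = (u (γ b) - u (γ a)) + (v (γ b) - v (γ a)) := by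
          simp only [Pi.add_apply]; ring
        rw [this]
        exact abs_add_le _ _
    _ = ENNReal.ofReal |u (γ b) - u (γ a)| + ENNReal.ofReal |v (γ b) - v (γ a)| :=
        ENNReal.ofReal_add (abs_nonneg _) (abs_nonneg _)
    _ ≤ curveIntegral g γ a b + curveIntegral h γ a b :=
        add_le_add (hu.2 a b γ hab hc hr) (hv.2 a b γ hab hc hr)
    _ ≤ curveIntegral (g + h) γ a b := le_lintegral_add _ _

theorem IsUpperGradient.smul {X : Type*} [MetricSpace X] [MeasurableSpace X]
    {u : X → ℝ} {g : X → ℝ≥0∞} (hu : IsUpperGradient u g) (c : ℝ) :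
    IsUpperGradient (c • u) (fun x => ENNReal.ofReal |c| * g x) := by
  refine ⟨hu.1.const_mul _, fun a b γ hab hc hr => ?_⟩
  calc ENNReal.ofReal |(c • u) (γ b) - (c • u) (γ a)|
      = ENNReal.ofReal |c| * ENNReal.ofReal |u (γ b) - u (γ a)| := by
        rw [← ENNReal.ofReal_mul (abs_nonneg _), ← abs_mul]
        simp only [Pi.smul_apply, smul_eq_mul, mul_sub]
    _ ≤ ENNReal.ofReal |c| * curveIntegral g γ a b := by
        gcongr
        exact hu.2 a b γ hab hc hr
    _ ≤ curveIntegral (fun x => ENNReal.ofReal |c| * g x) γ a b := lintegral_const_mul_le _ _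

/-- The Newton-Sobolev space `N^{1,2}(X)`: square integrable functions that have a square
integrable upper gradient. -/
def N12 {X : Type*} [MetricSpace X] [MeasurableSpace X] (μ : Measure X) :
    Submodule ℝ (X → ℝ) where
  carrier := {u | MemLp u 2 μ ∧ ∃ g, IsUpperGradient u g ∧ ∫⁻ x, g x ^ 2 ∂μ < ∞}
  zero_mem' := ⟨MemLp.zero, 0, IsUpperGradient.zero, by simp⟩
  add_mem' := by
    rintro u v ⟨hu, g, hg, hg2⟩ ⟨hv, h, hh, hh2⟩
    refine ⟨hu.add hv, g + h, hg.add hh, ?_⟩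
    have hle : ∀ x, (g + h) x ^ 2 ≤ 4 * g x ^ 2 + 4 * h x ^ 2 := by
      intro x
      have key : ∀ s t : ℝ≥0∞, s ≤ t → (s + t) ^ 2 ≤ 4 * t ^ 2 := by
        intro s t hst
        calc (s + t) ^ 2 ≤ (t + t) ^ 2 := by gcongr
          _ = 4 * t ^ 2 := by ring
      rcases le_total (g x) (h x) with hx | hx
      · exact (key _ _ hx).trans le_add_self
      · rw [Pi.add_apply, add_comm (g x)]
        exact (key _ _ hx).trans le_self_add
    calc ∫⁻ x, (g + h) x ^ 2 ∂μ ≤ ∫⁻ x, (4 * g x ^ 2 + 4 * h x ^ 2) ∂μ := lintegral_mono hle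
      _ = 4 * ∫⁻ x, g x ^ 2 ∂μ + 4 * ∫⁻ x, h x ^ 2 ∂μ := by
        rw [lintegral_add_left ((hg.1.pow_const 2).const_mul 4),
          lintegral_const_mul _ (hg.1.pow_const 2), lintegral_const_mul _ (hh.1.pow_const 2)]
      _ < ∞ := ENNReal.add_lt_top.2
        ⟨ENNReal.mul_lt_top (by simp) hg2, ENNReal.mul_lt_top (by simp) hh2⟩
  smul_mem' := by
    rintro c u ⟨hu, g, hg, hg2⟩
    refine ⟨hu.const_smul c, _, hg.smul c, ?_⟩
    simp_rw [mul_pow]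
    rw [lintegral_const_mul _ (hg.1.pow_const 2)]
    exact ENNReal.mul_lt_top (ENNReal.pow_lt_top ENNReal.ofReal_lt_top) hg2

/-- The upper gradient energy: the infimum of `∫ g² dμ` over all upper gradients `g` of `u`. -/
def upperGradientEnergy {X : Type*} [MetricSpace X] [MeasurableSpace X] (μ : Measure X)
    (u : X → ℝ) : ℝ≥0∞ :=
  ⨅ (g : X → ℝ≥0∞) (_ : IsUpperGradient u g), ∫⁻ x, g x ^ 2 ∂μ

/-- The norm of `N^{1,2}(X)`. -/
def newtonNorm {X : Type*} [MetricSpace X] [MeasurableSpace X] (μ : Measure X)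
    (u : X → ℝ) : ℝ≥0∞ :=
  (∫⁻ x, ENNReal.ofReal (u x ^ 2) ∂μ + upperGradientEnergy μ u) ^ (1 / 2 : ℝ)

/-- Convergence of a sequence in the norm of `N^{1,2}(X)`. -/
def NewtonTendsto {X : Type*} [MetricSpace X] [MeasurableSpace X] {μ : Measure X}
    (u : ℕ → N12 μ) (v : N12 μ) : Prop :=
  Tendsto (fun k => newtonNorm μ (u k - v : N12 μ)) atTop (𝓝 0)

/-- `S` is an `r`-separated set whose `r`-balls cover the space. -/
def IsNet {X : Type*} [MetricSpace X] (r : ℝ) (S : Set X) : Prop :=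
  (∀ x ∈ S, ∀ y ∈ S, x ≠ y → r ≤ dist x y) ∧ ⋃ x ∈ S, Metric.ball x r = univ

/-- The graph with vertex set `S`, in which `x ≠ y` are neighbors when their `2r`-balls meet. -/
def netGraph {X : Type*} [MetricSpace X] (S : Set X) (r : ℝ) : SimpleGraph S where
  Adj x y := x ≠ y ∧ (Metric.ball (x : X) (2 * r) ∩ Metric.ball (y : X) (2 * r)).Nonempty
  symm := ⟨fun _ _ h => ⟨h.1.symm, by rw [inter_comm]; exact h.2⟩⟩
  loopless := ⟨fun _ h => h.1 rfl⟩

/-- The discretization `u_r` of `u`: its mean value over the ball of radius `r / 4`. -/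
def discretize {X : Type*} [MetricSpace X] [MeasurableSpace X] (μ : Measure X) (r : ℝ)
    (u : X → ℝ) (x : X) : ℝ :=
  ⨍ z in Metric.ball x (r / 4), u z ∂μ

/-- The contribution of the pair `(x, y)` of neighbors to the graph form; the weight of the vertex
`x` is the measure of the ball of radius `2r`. -/
def edgeTerm {X : Type*} [MetricSpace X] [MeasurableSpace X] (μ : Measure X) (r : ℝ)
    (u v : X → ℝ) (x y : X) : ℝ :=
  (discretize μ r u y - discretize μ r u x) * (discretize μ r v y - discretize μ r v x) / r ^ 2 *
    μ.real (Metric.ball x (2 * r))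

/-- The approximating form `ℰ_r(u, v)`: the sum of `edgeTerm` over all `x ∈ S` and all neighbors
`y` of `x`. -/
def approxForm {X : Type*} [MetricSpace X] [MeasurableSpace X] (μ : Measure X) (S : Set X)
    (r : ℝ) (u v : X → ℝ) : ℝ :=
  ∑' p : (x : S) × (netGraph S r).neighborSet x, edgeTerm μ r u v (p.1 : X) (p.2.1 : X)

/-- `Q` is the `Γ`-limit on `N^{1,2}(X)` of the sequence of energies `F k`: the lower bound holds
along all convergent sequences, and every function has a recovery sequence. -/
def IsGammaLimit {X : Type*} [MetricSpace X] [MeasurableSpace X] {μ : Measure X}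
    (F : ℕ → N12 μ → ℝ) (Q : N12 μ → EReal) : Prop :=
  (∀ (u : ℕ → N12 μ) (v : N12 μ), NewtonTendsto u v →
    Q v ≤ liminf (fun k => (F k (u k) : EReal)) atTop) ∧
  ∀ v : N12 μ, ∃ u : ℕ → N12 μ, NewtonTendsto u v ∧
    limsup (fun k => (F k (u k) : EReal)) atTop ≤ Q v

/-- The support of `u` as an element of `L²(μ)`: the points all of whose neighborhoods meet
`{u ≠ 0}` in positive measure. -/
def essSupport {X : Type*} [MetricSpace X] [MeasurableSpace X] (μ : Measure X)
    (u : X → ℝ) : Set X :=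
  (μ.restrict (Function.support u)).support

/-- The essential support lies in the closure of `{u ≠ 0}`, so that functions with disjoint
topological supports have disjoint essential supports. -/
theorem essSupport_subset_tsupport {X : Type*} [MetricSpace X] [MeasurableSpace X]
    [BorelSpace X] (μ : Measure X) (u : X → ℝ) : essSupport μ u ⊆ tsupport u := by
  refine Measure.support_subset_of_isClosed (isClosed_tsupport u) ?_
  rw [mem_ae_iff, Measure.restrict_apply (isClosed_tsupport u).measurableSet.compl]
  have : (tsupport u)ᶜ ∩ Function.support u = ∅ :=
    (disjoint_compl_left_iff_subset.2 (subset_tsupport u)).inter_eq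
  rw [this, measure_empty]

end GraphForm

end

/-!
The proof compares the graph energies with the upper gradient energy, uniformly in the scale.

* *One edge.* If `x ∼ y`, the balls `B(x, r / 4)` and `B(y, r / 4)` lie in `B(x, 5r)`, and by doubling
  their measures are comparable to that of `B(x, 5r)`. Hence both mean values differ from the mean of
  `u` over `B(x, 5r)` by at most a constant times the mean oscillation there, and the Poincaré
  inequality bounds the edge term by `K ∫_{B(x, 5r)} g²` (`exists_edgeTerm_self_le`).
* *All edges.* By doubling, a ball of radius `9r` contains boundedly many points of an `r`-net
  (`card_le_of_separated`), so the balls `B(x, 5r)` overlap boundedly often, and the edge bounds add up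
  to `∑ |edgeTerm| ≤ K ∫_T (g² + h²)`, where `T` contains the balls of all edges that contribute
  (`exists_tsum_edgeTerm_le`). With `T = X` this is absolute convergence, and
  `ℰ_r[u] ≤ K ‖u‖²` with `K` independent of `r`.
* *The limit.* The energies are thus uniformly bounded squares of seminorms. If `u_k → v` in norm,
  Cauchy-Schwarz gives `ℰ_{r_k}[u_k] - ℰ_{r_k}[v] → 0`, so a recovery sequence can be replaced by the
  constant one, and the `Γ`-limit is a pointwise limit (`IsGammaLimit.exists_tendsto`). Polarization
  then shows that it is the quadratic form of a symmetric bilinear form.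
* *Locality.* An edge contributes to `ℰ_r(u, v)` only if `B(x, 5r)` lies in the `10r`-neighborhoods of
  both supports. When the supports are disjoint, every point of the space leaves the intersection
  of these neighborhoods for small `r`, and dominated convergence yields `ℰ_{r_k}(u, v) → 0`.
-/

namespace GraphForm

variable {X : Type*} [MetricSpace X] [MeasurableSpace X] {μ : Measure X}

/-! ### Doubling measures and nets -/

theorem measure_ball_two_pow_mul_le {C : ℝ≥0}
    (hC : ∀ (x : X) (r : ℝ), 0 < r → μ (Metric.ball x (2 * r)) ≤ C * μ (Metric.ball x r))
    (m : ℕ) (x : X) {r : ℝ} (hr : 0 < r) :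
    μ (Metric.ball x (2 ^ m * r)) ≤ C ^ m * μ (Metric.ball x r) := by
  induction m with
  | zero => simp
  | succ m ih =>
    calc μ (Metric.ball x (2 ^ (m + 1) * r)) = μ (Metric.ball x (2 * (2 ^ m * r))) := by
          rw [pow_succ']; ring_nf
      _ ≤ C * μ (Metric.ball x (2 ^ m * r)) := hC x _ (by positivity)
      _ ≤ C * (C ^ m * μ (Metric.ball x r)) := by gcongr
      _ = C ^ (m + 1) * μ (Metric.ball x r) := by rw [pow_succ']; ring

theorem IsDoubling.measure_ball_lt_top [IsLocallyFiniteMeasure μ] (h : IsDoubling μ) (x : X)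
    (r : ℝ) : μ (Metric.ball x r) < ∞ := by
  obtain ⟨C, hC⟩ := h
  obtain ⟨s, hs, hsfin⟩ := μ.finiteAt_nhds x
  obtain ⟨ε, hε, hεs⟩ := Metric.mem_nhds_iff.1 hs
  obtain ⟨m, hm⟩ := pow_unbounded_of_one_lt (r / ε) (one_lt_two)
  calc μ (Metric.ball x r) ≤ μ (Metric.ball x (2 ^ m * ε)) :=
        measure_mono (Metric.ball_subset_ball ((div_lt_iff₀ hε).1 hm).le)
    _ ≤ C ^ m * μ (Metric.ball x ε) := measure_ball_two_pow_mul_le hC m x hε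
    _ < ∞ := ENNReal.mul_lt_top (by simp) ((measure_mono hεs).trans_lt hsfin)

/-- Volume comparison: the disjoint balls of radius `r / 2` around the points of an `r`-separated
set in `B(z, ρ)` each carry a fixed fraction of the measure of `B(z, ρ + r / 2)`. -/
theorem card_le_of_separated [BorelSpace X] [IsLocallyFiniteMeasure μ] [μ.IsOpenPosMeasure]
    {C : ℝ≥0}
    (hC : ∀ (x : X) (r : ℝ), 0 < r → μ (Metric.ball x (2 * r)) ≤ C * μ (Metric.ball x r))
    {m : ℕ} {z : X} {r ρ : ℝ} (hr : 0 < r) (hρ : 0 ≤ ρ) (hm : 2 * ρ + r ≤ 2 ^ m * (r / 2))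
    (F : Finset X) (hsep : ∀ x ∈ F, ∀ y ∈ F, x ≠ y → r ≤ dist x y)
    (hF : ∀ x ∈ F, dist x z < ρ) : (F.card : ℝ≥0∞) ≤ C ^ m := by
  set M := μ (Metric.ball z (ρ + r / 2)) with hM
  have hM0 : M ≠ 0 := (Metric.measure_ball_pos μ z (by positivity)).ne'
  have hMtop : M ≠ ∞ := (IsDoubling.measure_ball_lt_top ⟨C, hC⟩ z _).ne
  have hx : ∀ x ∈ F, M ≤ C ^ m * μ (Metric.ball x (r / 2)) := fun x hxF =>
    calc M ≤ μ (Metric.ball x (2 ^ m * (r / 2))) := by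
          refine measure_mono (Metric.ball_subset_ball' ?_)
          have := hF x hxF
          rw [dist_comm] at this
          linarith
      _ ≤ C ^ m * μ (Metric.ball x (r / 2)) := measure_ball_two_pow_mul_le hC m x (by positivity)
  have hdisj : (F : Set X).PairwiseDisjoint fun x => Metric.ball x (r / 2) := by
    intro x hx y hy hxy
    exact Metric.ball_disjoint_ball (by linarith [hsep x hx y hy hxy])
  have hsum : ∑ x ∈ F, μ (Metric.ball x (r / 2)) ≤ M := by
    rw [← measure_biUnion_finset hdisj fun _ _ => Metric.isOpen_ball.measurableSet]
    refine measure_mono (iUnion₂_subset fun x hxF => Metric.ball_subset_ball' ?_)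
    linarith [hF x hxF]
  have : (F.card : ℝ≥0∞) * M ≤ C ^ m * M :=
    calc (F.card : ℝ≥0∞) * M = ∑ x ∈ F, M := by simp
      _ ≤ ∑ x ∈ F, C ^ m * μ (Metric.ball x (r / 2)) := Finset.sum_le_sum hx
      _ = C ^ m * ∑ x ∈ F, μ (Metric.ball x (r / 2)) := by rw [Finset.mul_sum]
      _ ≤ C ^ m * M := by gcongr
  exact (ENNReal.mul_le_mul_iff_left hM0 hMtop).1 this

theorem IsNet.countable [BorelSpace X] [IsLocallyFiniteMeasure μ] [μ.IsOpenPosMeasure]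
    (h : IsDoubling μ) {r : ℝ} (hr : 0 < r) {S : Set X} (hS : IsNet r S) : S.Countable := by
  obtain ⟨C, hC⟩ := h
  rcases S.eq_empty_or_nonempty with rfl | ⟨o, -⟩
  · exact countable_empty
  have hcover : S ⊆ ⋃ n : ℕ, S ∩ Metric.ball o n := fun x hx => by
    obtain ⟨n, hn⟩ := exists_nat_gt (dist x o)
    exact mem_iUnion.2 ⟨n, hx, hn⟩
  refine (countable_iUnion fun n => Set.Finite.countable ?_).mono hcover
  by_contra hinf
  obtain ⟨m, hm⟩ := pow_unbounded_of_one_lt ((2 * n + r) / (r / 2)) one_lt_two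
  obtain ⟨N, hN⟩ := exists_nat_gt (C ^ m)
  obtain ⟨F, hFsub, hFcard⟩ := Set.Infinite.exists_subset_card_eq hinf N
  have hle := card_le_of_separated hC (m := m) (z := o) hr n.cast_nonneg
    ((div_lt_iff₀ (by positivity)).1 hm).le F
    (fun x hx y hy => hS.1 x (hFsub hx).1 y (hFsub hy).1) fun x hx => (hFsub hx).2
  rw [hFcard] at hle
  exact absurd hN (not_lt.2 (by exact_mod_cast hle))

theorem IsDoubling.secondCountableTopology [BorelSpace X] [IsLocallyFiniteMeasure μ]
    [μ.IsOpenPosMeasure] (h : IsDoubling μ) {net : ℝ → Set X}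
    (hnet : ∀ r : ℝ, 0 < r → IsNet r (net r)) : SecondCountableTopology X := by
  refine Metric.secondCountable_of_almost_dense_set fun ε hε =>
    ⟨net ε, (hnet ε hε).countable h hε, fun x => ?_⟩
  have hx : x ∈ ⋃ y ∈ net ε, Metric.ball y ε := (hnet ε hε).2 ▸ mem_univ x
  obtain ⟨y, hy, hxy⟩ := mem_iUnion₂.1 hx
  exact ⟨y, hy, le_of_lt hxy⟩

/-! ### The contribution of one edge -/

theorem netGraph_adj_dist_lt {X : Type*} [MetricSpace X] {S : Set X} {r : ℝ} {x y : S}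
    (h : (netGraph S r).Adj x y) :
    dist (x : X) y < 4 * r := by
  obtain ⟨-, z, hx, hy⟩ := h
  rw [Metric.mem_ball] at hx hy
  linarith [dist_triangle_left (x : X) y z]

theorem ofReal_abs_discretize_sub_le [BorelSpace X] [IsLocallyFiniteMeasure μ]
    [μ.IsOpenPosMeasure] (h : IsDoubling μ) {u : X → ℝ} (hu : MemLp u 2 μ) {r : ℝ} (hr : 0 < r)
    (y : X) {B : Set X} (hB : Metric.ball y (r / 4) ⊆ B) (hBtop : μ B ≠ ∞) (c : ℝ) :
    ENNReal.ofReal |discretize μ r u y - c| ≤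
      μ B / μ (Metric.ball y (r / 4)) * ⨍⁻ z in B, ENNReal.ofReal |u z - c| ∂μ := by
  set A := Metric.ball y (r / 4)
  have hA0 : μ A ≠ 0 := (Metric.measure_ball_pos μ y (by positivity)).ne'
  have hAtop : μ A ≠ ∞ := (h.measure_ball_lt_top y _).ne
  have hB0 : μ B ≠ 0 := fun h0 => hA0 (measure_mono_null hB h0)
  have : IsFiniteMeasure (μ.restrict A) := ⟨by simpa using hAtop.lt_top⟩
  have hint : Integrable u (μ.restrict A) := (hu.restrict A).integrable (by norm_num)
  have hmean : discretize μ r u y - c = ∫ z, (u z - c) ∂((μ A)⁻¹ • μ.restrict A) := by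
    have hp : ((μ A)⁻¹ • μ.restrict A) univ = 1 := by
      simp [ENNReal.inv_mul_cancel hA0 hAtop]
    have : IsProbabilityMeasure ((μ A)⁻¹ • μ.restrict A) := ⟨hp⟩
    rw [integral_sub (hint.smul_measure (ENNReal.inv_ne_top.2 hA0)) (integrable_const c)]
    simp only [integral_const, probReal_univ, one_smul]
    rw [discretize, setAverage_eq']
  calc ENNReal.ofReal |discretize μ r u y - c|
      = ‖∫ z, (u z - c) ∂((μ A)⁻¹ • μ.restrict A)‖ₑ := by
        rw [hmean, ← Real.norm_eq_abs, ofReal_norm]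
    _ ≤ ∫⁻ z, ‖u z - c‖ₑ ∂((μ A)⁻¹ • μ.restrict A) := enorm_integral_le_lintegral_enorm _
    _ = (μ A)⁻¹ * ∫⁻ z in A, ENNReal.ofReal |u z - c| ∂μ := by
        simp_rw [lintegral_smul_measure, ← Real.norm_eq_abs, ofReal_norm, smul_eq_mul]
    _ ≤ (μ A)⁻¹ * ∫⁻ z in B, ENNReal.ofReal |u z - c| ∂μ := by
        gcongr
    _ = μ B / μ A * ⨍⁻ z in B, ENNReal.ofReal |u z - c| ∂μ := by
        rw [setLAverage_eq, div_eq_mul_inv, div_eq_mul_inv]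
        rw [show μ B * (μ A)⁻¹ * ((∫⁻ z in B, ENNReal.ofReal |u z - c| ∂μ) * (μ B)⁻¹) =
          (μ B * (μ B)⁻¹) * ((μ A)⁻¹ * ∫⁻ z in B, ENNReal.ofReal |u z - c| ∂μ) by ring,
          ENNReal.mul_inv_cancel hB0 hBtop, one_mul]

/-- Both mean values differ from the mean over `B(x, 5r)` by at most a multiple of the mean
oscillation there, which the Poincaré inequality controls. -/
theorem exists_edgeTerm_self_le [BorelSpace X] [IsLocallyFiniteMeasure μ] [μ.IsOpenPosMeasure]
    (h : IsDoubling μ) (hP : SupportsPoincare μ) :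
    ∃ K : ℝ≥0, ∀ (r : ℝ) (u : X → ℝ) (g : X → ℝ≥0∞) (x y : X), 0 < r → MemLp u 2 μ →
      IsUpperGradient u g → dist x y < 4 * r →
      ENNReal.ofReal (edgeTerm μ r u u x y) ≤ K * ∫⁻ z in Metric.ball x (5 * r), g z ^ 2 ∂μ := by
  obtain ⟨P, hP⟩ := hP
  obtain ⟨C, hC⟩ := id h
  refine ⟨100 * C ^ 12 * P ^ 2, fun r u g x y hr hu hg hxy => ?_⟩
  set B := Metric.ball x (5 * r) with hB
  have hB0 : μ B ≠ 0 := (Metric.measure_ball_pos μ x (by positivity)).ne'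
  have hBtop : μ B ≠ ∞ := (h.measure_ball_lt_top x _).ne
  set c := ⨍ z in B, u z ∂μ
  set I := ⨍⁻ z in B, ENNReal.ofReal |u z - c| ∂μ
  set G := ⨍⁻ z in B, g z ^ 2 ∂μ with hG
  have hI : I ≤ P * ENNReal.ofReal (5 * r) * G ^ (1 / 2 : ℝ) :=
    hP u g (hu.locallyIntegrable (by norm_num)) hg x (5 * r) (by positivity)
  -- `B(x, 5r) ⊆ B(w, 9r) ⊆ B(w, 2 ^ 6 * (r / 4))`
  have hmean : ∀ w, dist w x < 4 * r →
      ENNReal.ofReal |discretize μ r u w - c| ≤ C ^ 6 * I := fun w hw => by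
    refine (ofReal_abs_discretize_sub_le h hu hr w
      (Metric.ball_subset_ball' (by linarith)) hBtop c).trans ?_
    gcongr
    refine ENNReal.div_le_of_le_mul ?_
    refine le_trans (measure_mono (Metric.ball_subset_ball' ?_))
      (measure_ball_two_pow_mul_le hC 6 w (by positivity))
    rw [dist_comm]
    linarith
  have hdiff : ENNReal.ofReal |discretize μ r u y - discretize μ r u x| ≤ 2 * C ^ 6 * I :=
    calc ENNReal.ofReal |discretize μ r u y - discretize μ r u x|
        ≤ ENNReal.ofReal (|discretize μ r u y - c| + |discretize μ r u x - c|) := by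
          apply ENNReal.ofReal_le_ofReal
          rw [abs_sub_comm (discretize μ r u x) c]
          exact abs_sub_le _ _ _
      _ = _ := ENNReal.ofReal_add (abs_nonneg _) (abs_nonneg _)
      _ ≤ C ^ 6 * I + C ^ 6 * I :=
          add_le_add (hmean y (by rwa [dist_comm])) (hmean x (by simpa using hr))
      _ = 2 * C ^ 6 * I := by ring
  have hr2 : ENNReal.ofReal r ≠ 0 := by simpa using hr
  have hr3 : ENNReal.ofReal r ^ 2 ≠ 0 := pow_ne_zero 2 hr2
  have hGsq : (G ^ (1 / 2 : ℝ)) ^ 2 = G := by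
    rw [← ENNReal.rpow_natCast, ← ENNReal.rpow_mul]
    norm_num
  calc ENNReal.ofReal (edgeTerm μ r u u x y)
      = ENNReal.ofReal |discretize μ r u y - discretize μ r u x| ^ 2 / ENNReal.ofReal r ^ 2 *
          μ (Metric.ball x (2 * r)) := by
        rw [edgeTerm, ENNReal.ofReal_mul (div_nonneg (mul_self_nonneg _) (sq_nonneg _)),
          ENNReal.ofReal_div_of_pos (by positivity),
          ENNReal.ofReal_pow hr.le, ← ENNReal.ofReal_pow (abs_nonneg _), sq_abs, ← sq,
          measureReal_def, ENNReal.ofReal_toReal (h.measure_ball_lt_top x _).ne]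
    _ ≤ (2 * C ^ 6 * (P * (5 * ENNReal.ofReal r) * G ^ (1 / 2 : ℝ))) ^ 2 / ENNReal.ofReal r ^ 2 *
          μ B := by
        gcongr
        · refine hdiff.trans ?_
          gcongr
          rwa [ENNReal.ofReal_mul (by norm_num), ENNReal.ofReal_ofNat] at hI
        · exact Metric.ball_subset_ball (by linarith)
    _ = 100 * C ^ 12 * P ^ 2 * (ENNReal.ofReal r ^ 2 * (ENNReal.ofReal r ^ 2)⁻¹) *
          ((G ^ (1 / 2 : ℝ)) ^ 2 * μ B) := by rw [div_eq_mul_inv]; ring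
    _ = 100 * C ^ 12 * P ^ 2 * ∫⁻ z in B, g z ^ 2 ∂μ := by
        rw [ENNReal.mul_inv_cancel hr3 (by simp), mul_one, hGsq, hG, setLAverage_eq,
          ENNReal.div_mul_cancel hB0 hBtop]
    _ = _ := by push_cast; rfl

theorem two_mul_abs_edgeTerm_le (r : ℝ) (u v : X → ℝ) (x y : X) :
    2 * |edgeTerm μ r u v x y| ≤ edgeTerm μ r u u x y + edgeTerm μ r v v x y := by
  simp only [edgeTerm]
  set a := discretize μ r u y - discretize μ r u x
  set b := discretize μ r v y - discretize μ r v x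
  have hm : 0 ≤ μ.real (Metric.ball x (2 * r)) := measureReal_nonneg
  rw [abs_mul, abs_div, abs_of_nonneg hm, abs_of_nonneg (sq_nonneg r), abs_mul, ← mul_assoc,
    ← add_mul, ← add_div, mul_div_assoc']
  gcongr
  nlinarith [sq_nonneg (|a| - |b|), abs_mul_abs_self a, abs_mul_abs_self b]

theorem edgeTerm_self_nonneg (r : ℝ) (u : X → ℝ) (x y : X) : 0 ≤ edgeTerm μ r u u x y :=
  mul_nonneg (div_nonneg (mul_self_nonneg _) (sq_nonneg _)) measureReal_nonneg

theorem edgeTerm_comm (r : ℝ) (u v : X → ℝ) (x y : X) :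
    edgeTerm μ r u v x y = edgeTerm μ r v u x y := by
  simp only [edgeTerm]; ring

theorem ofReal_abs_edgeTerm_le {K : ℝ≥0} {r : ℝ} {u v : X → ℝ} {g h : X → ℝ≥0∞} {x y : X}
    {B : Set X} (hg : Measurable g)
    (hu : ENNReal.ofReal (edgeTerm μ r u u x y) ≤ K * ∫⁻ z in B, g z ^ 2 ∂μ)
    (hv : ENNReal.ofReal (edgeTerm μ r v v x y) ≤ K * ∫⁻ z in B, h z ^ 2 ∂μ) :
    ENNReal.ofReal |edgeTerm μ r u v x y| ≤ K * ∫⁻ z in B, (g z ^ 2 + h z ^ 2) ∂μ :=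
  calc ENNReal.ofReal |edgeTerm μ r u v x y|
      ≤ ENNReal.ofReal (edgeTerm μ r u u x y + edgeTerm μ r v v x y) := by
        apply ENNReal.ofReal_le_ofReal
        linarith [two_mul_abs_edgeTerm_le (μ := μ) r u v x y, abs_nonneg (edgeTerm μ r u v x y)]
    _ ≤ ENNReal.ofReal (edgeTerm μ r u u x y) + ENNReal.ofReal (edgeTerm μ r v v x y) :=
        ENNReal.ofReal_add_le
    _ ≤ K * ∫⁻ z in B, g z ^ 2 ∂μ + K * ∫⁻ z in B, h z ^ 2 ∂μ := add_le_add hu hv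
    _ = K * ∫⁻ z in B, (g z ^ 2 + h z ^ 2) ∂μ := by
        rw [lintegral_add_left (hg.pow_const 2), mul_add]

/-! ### Summation over the edges -/

/-- The balls `B(x, 5r)`, one for each edge with first vertex `x`, overlap boundedly often. So the
sum of the absolute edge terms is controlled by the integral over any set `T` that contains the
balls of those edges which contribute. -/
theorem exists_tsum_edgeTerm_le [BorelSpace X] [IsLocallyFiniteMeasure μ] [μ.IsOpenPosMeasure]
    (hd : IsDoubling μ) (hP : SupportsPoincare μ) :
    ∃ K : ℝ≥0, ∀ (r : ℝ) (S : Set X) (u v : X → ℝ) (g h : X → ℝ≥0∞) (T : Set X), 0 < r →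
      IsNet r S → MemLp u 2 μ → MemLp v 2 μ → IsUpperGradient u g → IsUpperGradient v h →
      MeasurableSet T →
      (∀ x ∈ S, ∀ y ∈ S, dist x y < 4 * r → edgeTerm μ r u v x y ≠ 0 →
        Metric.ball x (5 * r) ⊆ T) →
      ∑' p : (x : S) × (netGraph S r).neighborSet x,
        ENNReal.ofReal |edgeTerm μ r u v (p.1 : X) (p.2.1 : X)| ≤
          K * ∫⁻ z in T, (g z ^ 2 + h z ^ 2) ∂μ := by
  obtain ⟨K, hK⟩ := exists_edgeTerm_self_le hd hP
  obtain ⟨C, hC⟩ := id hd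
  -- the constant of `card_le_of_separated` for `ρ = 9r`
  have hρ : ∀ r : ℝ, 0 < r → 2 * (9 * r) + r ≤ 2 ^ 6 * (r / 2) := fun r hr => by linarith
  refine ⟨K * (C ^ 6 * C ^ 6), fun r S u v g h T hr hS hu hv hg hh hT hsupp => ?_⟩
  classical
  rw [ENNReal.tsum_eq_iSup_sum]
  refine iSup_le fun F => ?_
  set f : X → ℝ≥0∞ := fun z => g z ^ 2 + h z ^ 2 with hf
  have hfm : Measurable f := (hg.1.pow_const 2).add (hh.1.pow_const 2)
  have hball : ∀ x : X, MeasurableSet (Metric.ball x (5 * r)) :=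
    fun x => Metric.isOpen_ball.measurableSet
  have hterm : ∀ p ∈ F, ENNReal.ofReal |edgeTerm μ r u v (p.1 : X) (p.2.1 : X)| ≤
      K * ∫⁻ z in T, (Metric.ball (p.1 : X) (5 * r)).indicator f z ∂μ := fun p _ => by
    have hdist := netGraph_adj_dist_lt p.2.2
    by_cases h0 : edgeTerm μ r u v (p.1 : X) (p.2.1 : X) = 0
    · simp [h0]
    · rw [setLIntegral_indicator (hball _),
        inter_eq_left.2 (hsupp _ p.1.2 _ p.2.1.2 hdist h0)]
      exact ofReal_abs_edgeTerm_le hg.1 (hK r u g _ _ hr hu hg hdist) (hK r v h _ _ hr hv hh hdist)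
  have hcount : ∀ z, ∑ p ∈ F, (Metric.ball (p.1 : X) (5 * r)).indicator f z ≤
      C ^ 6 * C ^ 6 * f z := fun z => by
    set A := F.filter fun p => z ∈ Metric.ball (p.1 : X) (5 * r) with hA
    -- both vertices of an edge counted at `z` lie in `B(z, 9r)`
    have hA1 : ∀ p ∈ A, dist (p.1 : X) z < 9 * r := fun p hp => by
      have := (Finset.mem_filter.1 hp).2
      rw [Metric.mem_ball'] at this
      linarith
    have hA2 : ∀ p ∈ A, dist (p.2.1 : X) z < 9 * r := fun p hp => by
      have h1 := (Finset.mem_filter.1 hp).2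
      have h2 := netGraph_adj_dist_lt p.2.2
      rw [Metric.mem_ball'] at h1
      linarith [dist_triangle_left (p.2.1 : X) z (p.1 : X)]
    have hcard1 : ((A.image fun p => (p.1 : X)).card : ℝ≥0∞) ≤ C ^ 6 := by
      refine card_le_of_separated hC (z := z) hr (by positivity) (hρ r hr) _ ?_ ?_
      · simp only [Finset.mem_image]
        rintro _ ⟨p, -, rfl⟩ _ ⟨q, -, rfl⟩
        exact hS.1 _ p.1.2 _ q.1.2
      · simp only [Finset.mem_image]
        rintro _ ⟨p, hp, rfl⟩
        exact hA1 p hp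
    have hcard2 : ((A.image fun p => (p.2.1 : X)).card : ℝ≥0∞) ≤ C ^ 6 := by
      refine card_le_of_separated hC (z := z) hr (by positivity) (hρ r hr) _ ?_ ?_
      · simp only [Finset.mem_image]
        rintro _ ⟨p, -, rfl⟩ _ ⟨q, -, rfl⟩
        exact hS.1 _ p.2.1.2 _ q.2.1.2
      · simp only [Finset.mem_image]
        rintro _ ⟨p, hp, rfl⟩
        exact hA2 p hp
    have hcard : A.card ≤
        (A.image fun p => (p.1 : X)).card * (A.image fun p => (p.2.1 : X)).card := by
      rw [← Finset.card_product]
      refine Finset.card_le_card_of_injOn (fun p => ((p.1 : X), (p.2.1 : X)))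
        (fun p hp => ?_) ?_
      · exact Finset.mem_product.2 ⟨Finset.mem_image_of_mem _ hp, Finset.mem_image_of_mem _ hp⟩
      · rintro ⟨x, y⟩ - ⟨x', y'⟩ - hpq
        obtain ⟨h1, h2⟩ := Prod.mk.inj hpq
        obtain rfl : x = x' := Subtype.ext h1
        obtain rfl : y = y' := Subtype.ext (Subtype.ext h2)
        rfl
    calc ∑ p ∈ F, (Metric.ball (p.1 : X) (5 * r)).indicator f z
        = ∑ p ∈ A, f z := by
          simp only [hA, Finset.sum_filter, indicator_apply]
      _ = A.card * f z := by simp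
      _ ≤ C ^ 6 * C ^ 6 * f z := by
          gcongr
          exact (Nat.cast_le.2 hcard).trans (by push_cast; gcongr)
  calc ∑ p ∈ F, ENNReal.ofReal |edgeTerm μ r u v (p.1 : X) (p.2.1 : X)|
      ≤ ∑ p ∈ F, K * ∫⁻ z in T, (Metric.ball (p.1 : X) (5 * r)).indicator f z ∂μ :=
        Finset.sum_le_sum hterm
    _ = K * ∫⁻ z in T, ∑ p ∈ F, (Metric.ball (p.1 : X) (5 * r)).indicator f z ∂μ := by
        rw [lintegral_finsetSum _ fun p _ => hfm.indicator (hball _), Finset.mul_sum]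
    _ ≤ K * ∫⁻ z in T, C ^ 6 * C ^ 6 * f z ∂μ := by
        gcongr with z
        exact hcount z
    _ = (K * (C ^ 6 * C ^ 6) : ℝ≥0) * ∫⁻ z in T, f z ∂μ := by
        rw [lintegral_const_mul _ hfm]; push_cast; ring

/-! ### The approximating forms -/

theorem discretize_add [IsLocallyFiniteMeasure μ] (h : IsDoubling μ) (r : ℝ) {u v : X → ℝ}
    (hu : MemLp u 2 μ) (hv : MemLp v 2 μ) (x : X) :
    discretize μ r (u + v) x = discretize μ r u x + discretize μ r v x := by
  have : IsFiniteMeasure (μ.restrict (Metric.ball x (r / 4))) :=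
    ⟨by simpa using h.measure_ball_lt_top x _⟩
  simp only [discretize, setAverage_eq, Pi.add_apply]
  rw [integral_add ((hu.restrict _).integrable (by norm_num))
    ((hv.restrict _).integrable (by norm_num)), smul_add]

theorem discretize_smul (r : ℝ) (c : ℝ) (u : X → ℝ) (x : X) :
    discretize μ r (c • u) x = c * discretize μ r u x := by
  simp only [discretize, setAverage_eq, Pi.smul_apply, smul_eq_mul, integral_const_mul]
  ring

theorem approxForm_comm (S : Set X) (r : ℝ) (u v : X → ℝ) :
    approxForm μ S r u v = approxForm μ S r v u :=
  tsum_congr fun _ => edgeTerm_comm r u v _ _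

theorem approxForm_self_nonneg (S : Set X) (r : ℝ) (u : X → ℝ) : 0 ≤ approxForm μ S r u u :=
  tsum_nonneg fun _ => edgeTerm_self_nonneg r u _ _

theorem ofReal_abs_tsum_le {ι : Type*} {f : ι → ℝ} (hf : Summable f) :
    ENNReal.ofReal |∑' i, f i| ≤ ∑' i, ENNReal.ofReal |f i| := by
  rw [← ENNReal.ofReal_tsum_of_nonneg (fun _ => abs_nonneg _) hf.abs]
  refine ENNReal.ofReal_le_ofReal ?_
  simpa only [Real.norm_eq_abs] using norm_tsum_le_tsum_norm hf.norm

theorem summable_of_tsum_ofReal_abs_ne_top {ι : Type*} {f : ι → ℝ}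
    (hf : ∑' i, ENNReal.ofReal |f i| ≠ ∞) : Summable f := by
  refine Summable.of_abs ?_
  simpa [ENNReal.toReal_ofReal (abs_nonneg _)] using ENNReal.summable_toReal hf

theorem N12.exists_upperGradient_pair (u v : N12 μ) :
    ∃ g h : X → ℝ≥0∞, IsUpperGradient (u : X → ℝ) g ∧ IsUpperGradient (v : X → ℝ) h ∧
      ∫⁻ x, (g x ^ 2 + h x ^ 2) ∂μ ≠ ∞ := by
  obtain ⟨-, g, hg, hg2⟩ := u.2
  obtain ⟨-, h, hh, hh2⟩ := v.2
  refine ⟨g, h, hg, hh, ?_⟩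
  rw [lintegral_add_left (hg.1.pow_const 2)]
  exact ENNReal.add_ne_top.2 ⟨hg2.ne, hh2.ne⟩

theorem summable_edgeTerm [BorelSpace X] [IsLocallyFiniteMeasure μ] [μ.IsOpenPosMeasure]
    (hd : IsDoubling μ) (hP : SupportsPoincare μ) {r : ℝ} (hr : 0 < r) {S : Set X}
    (hS : IsNet r S) (u v : N12 μ) :
    Summable fun p : (x : S) × (netGraph S r).neighborSet x =>
      edgeTerm μ r u v (p.1 : X) (p.2.1 : X) := by
  obtain ⟨K, hK⟩ := exists_tsum_edgeTerm_le hd hP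
  obtain ⟨g, h, hg, hh, hfin⟩ := N12.exists_upperGradient_pair u v
  refine summable_of_tsum_ofReal_abs_ne_top (ne_top_of_le_ne_top ?_
    (hK r S u v g h univ hr hS u.2.1 v.2.1 hg hh MeasurableSet.univ fun _ _ _ _ _ _ =>
      subset_univ _))
  rw [Measure.restrict_univ]
  exact ENNReal.mul_ne_top ENNReal.coe_ne_top hfin

/-- The approximating form at scale `r` as a bilinear form on `N^{1,2}(X)`. -/
noncomputable def approxBilin [BorelSpace X] [IsLocallyFiniteMeasure μ] [μ.IsOpenPosMeasure]
    (hd : IsDoubling μ) (hP : SupportsPoincare μ) {r : ℝ} (hr : 0 < r) {S : Set X}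
    (hS : IsNet r S) : LinearMap.BilinForm ℝ (N12 μ) :=
  have hadd : ∀ u u' v : N12 μ, approxForm μ S r (u + u' : N12 μ) v =
      approxForm μ S r u v + approxForm μ S r u' v := fun u u' v => by
    simp only [approxForm]
    rw [← (summable_edgeTerm hd hP hr hS u v).tsum_add (summable_edgeTerm hd hP hr hS u' v)]
    refine tsum_congr fun p => ?_
    simp only [edgeTerm, Submodule.coe_add, discretize_add hd r u.2.1 u'.2.1]
    ring
  have hsmul : ∀ (c : ℝ) (u v : N12 μ), approxForm μ S r (c • u : N12 μ) v =
      c • approxForm μ S r u v := fun c u v => by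
    simp only [approxForm]
    rw [smul_eq_mul, ← tsum_mul_left]
    refine tsum_congr fun p => ?_
    simp only [edgeTerm, Submodule.coe_smul, discretize_smul]
    ring
  LinearMap.mk₂ ℝ (fun u v => approxForm μ S r u v) hadd hsmul
    (fun u v v' => by simp only [approxForm_comm S r (u : X → ℝ), hadd])
    (fun c u v => by simp only [approxForm_comm S r (u : X → ℝ), hsmul])

theorem approxBilin_apply [BorelSpace X] [IsLocallyFiniteMeasure μ] [μ.IsOpenPosMeasure]
    (hd : IsDoubling μ) (hP : SupportsPoincare μ) {r : ℝ} (hr : 0 < r) {S : Set X}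
    (hS : IsNet r S) (u v : N12 μ) :
    approxBilin hd hP hr hS u v = approxForm μ S r u v := rfl

theorem approxBilin_isSymm [BorelSpace X] [IsLocallyFiniteMeasure μ] [μ.IsOpenPosMeasure]
    (hd : IsDoubling μ) (hP : SupportsPoincare μ) {r : ℝ} (hr : 0 < r) {S : Set X}
    (hS : IsNet r S) : (approxBilin hd hP hr hS).IsSymm :=
  ⟨fun _ _ => approxForm_comm _ _ _ _⟩

/-- The approximating energies are bounded by the upper gradient energy, uniformly in the scale;
hence they are equicontinuous on `N^{1,2}(X)`. -/
theorem exists_approxForm_self_le [BorelSpace X] [IsLocallyFiniteMeasure μ] [μ.IsOpenPosMeasure]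
    (hd : IsDoubling μ) (hP : SupportsPoincare μ) :
    ∃ K : ℝ≥0, ∀ (r : ℝ) (S : Set X) (u : N12 μ), 0 < r → IsNet r S →
      ENNReal.ofReal (approxForm μ S r u u) ≤ K * upperGradientEnergy μ u := by
  obtain ⟨K, hK⟩ := exists_tsum_edgeTerm_le hd hP
  refine ⟨2 * K + 1, fun r S u hr hS => ?_⟩
  have hK0 : ((2 * K + 1 : ℝ≥0) : ℝ≥0∞) ≠ 0 := by positivity
  rw [mul_comm, ← ENNReal.div_le_iff hK0 ENNReal.coe_ne_top]
  refine le_iInf₂ fun g hg => ?_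
  rw [ENNReal.div_le_iff hK0 ENNReal.coe_ne_top, mul_comm]
  calc ENNReal.ofReal (approxForm μ S r u u)
      ≤ ENNReal.ofReal |approxForm μ S r u u| := ENNReal.ofReal_le_ofReal (le_abs_self _)
    _ ≤ _ := ofReal_abs_tsum_le (summable_edgeTerm hd hP hr hS u u)
    _ ≤ K * ∫⁻ z in univ, (g z ^ 2 + g z ^ 2) ∂μ :=
        hK r S u u g g univ hr hS u.2.1 u.2.1 hg hg MeasurableSet.univ fun _ _ _ _ _ _ =>
          subset_univ _
    _ = (2 * K) * ∫⁻ z, g z ^ 2 ∂μ := by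
        rw [Measure.restrict_univ, lintegral_add_left (hg.1.pow_const 2)]
        ring
    _ ≤ (2 * K + 1 : ℝ≥0) * ∫⁻ z, g z ^ 2 ∂μ := by
        push_cast
        gcongr
        exact le_self_add

theorem upperGradientEnergy_le_newtonNorm_sq (u : X → ℝ) :
    upperGradientEnergy μ u ≤ newtonNorm μ u ^ 2 := by
  rw [newtonNorm, ← ENNReal.rpow_natCast, ← ENNReal.rpow_mul]
  norm_num

theorem N12.upperGradientEnergy_ne_top (u : N12 μ) : upperGradientEnergy μ u ≠ ∞ := by
  obtain ⟨-, g, hg, hfin⟩ := u.2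
  exact ne_top_of_le_ne_top hfin.ne (iInf₂_le g hg)

/-! ### `Γ`-limits of equicontinuous energies -/

/-- If nonnegative quadratic forms `B k` are bounded by a multiple of the square of the norm, then
the errors along a recovery sequence vanish, so that a `Γ`-limit is a pointwise limit. -/
theorem IsGammaLimit.exists_tendsto {B : ℕ → LinearMap.BilinForm ℝ (N12 μ)} {Q : N12 μ → EReal}
    {K : ℝ≥0} (hsymm : ∀ k, (B k).IsSymm) (hnonneg : ∀ k u, 0 ≤ B k u u)
    (hbound : ∀ k u, ENNReal.ofReal (B k u u) ≤ K * upperGradientEnergy μ u)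
    (hQ : IsGammaLimit (fun k u => B k u u) Q) (v : N12 μ) :
    ∃ q : ℝ, Q v = q ∧ Tendsto (fun k => B k v v) atTop (𝓝 q) := by
  obtain ⟨hinf, hrec⟩ := hQ
  set M : ℝ := (K * upperGradientEnergy μ v).toReal with hM
  have hvM : ∀ k, B k v v ≤ M := fun k =>
    (ENNReal.ofReal_le_iff_le_toReal
      (ENNReal.mul_ne_top ENNReal.coe_ne_top (N12.upperGradientEnergy_ne_top v))).1 (hbound k v)
  obtain ⟨u, hu, huQ⟩ := hrec v
  obtain ⟨w, hwdef⟩ : ∃ w : ℕ → N12 μ, ∀ k, w k = u k - v := ⟨fun k => u k - v, fun _ => rfl⟩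
  have hwu : Tendsto (fun k => newtonNorm μ (w k)) atTop (𝓝 0) := by
    simp_rw [hwdef]
    exact hu
  have hw0 : Tendsto (fun k => B k (w k) (w k)) atTop (𝓝 0) := by
    have h1 : Tendsto (fun k => ENNReal.ofReal (B k (w k) (w k))) atTop (𝓝 0) := by
      refine tendsto_of_tendsto_of_tendsto_of_le_of_le tendsto_const_nhds
        (?_ : Tendsto (fun k => K * newtonNorm μ (w k) ^ 2) atTop (𝓝 0))
        (fun _ => zero_le) fun k => (hbound k _).trans ?_
      · have := ENNReal.Tendsto.const_mul (a := (K : ℝ≥0∞)) (ENNReal.Tendsto.pow (n := 2) hwu)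
          (Or.inr ENNReal.coe_ne_top)
        simpa using this
      · gcongr
        exact upperGradientEnergy_le_newtonNorm_sq _
    have h2 := (ENNReal.tendsto_toReal ENNReal.zero_ne_top).comp h1
    simpa [Function.comp_def, ENNReal.toReal_ofReal (hnonneg _ _)] using h2
  have hcross : Tendsto (fun k => B k v (w k)) atTop (𝓝 0) := by
    have hb : Tendsto (fun k => √(M * B k (w k) (w k))) atTop (𝓝 0) := by
      have := (hw0.const_mul M).sqrt
      simpa using this
    refine squeeze_zero_norm (fun k => ?_) hb
    refine Real.abs_le_sqrt (((B k).apply_sq_le_of_symm (hnonneg k)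
      (LinearMap.BilinForm.isSymm_iff.1 (hsymm k)) v _).trans ?_)
    exact mul_le_mul_of_nonneg_right (hvM k) (hnonneg k _)
  set e : ℕ → ℝ := fun k => -(2 * B k v (w k) + B k (w k) (w k)) with he
  have he0 : Tendsto e atTop (𝓝 0) := by
    simpa only [mul_zero, add_zero, neg_zero] using ((hcross.const_mul 2).add hw0).neg
  have hsplit : ∀ k, B k v v = B k (u k) (u k) + e k := fun k => by
    have h1 : u k = v + w k := by rw [hwdef k]; abel
    have h2 : B k (u k) (u k) = B k v v + 2 * B k v (w k) + B k (w k) (w k) := by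
      rw [h1, map_add, map_add, LinearMap.add_apply, LinearMap.add_apply,
        (hsymm k).eq (w k) v]
      ring
    rw [h2]
    simp only [he]
    ring
  have hconst : NewtonTendsto (fun _ : ℕ => v) v := by
    have h0 : upperGradientEnergy μ ((v - v : N12 μ) : X → ℝ) = 0 := by
      refine le_antisymm ((iInf₂_le 0 ?_).trans (by simp)) zero_le
      simpa using IsUpperGradient.zero
    simp only [NewtonTendsto, newtonNorm, h0]
    simp
  have hlow : Q v ≤ liminf (fun k => (B k v v : EReal)) atTop := hinf _ v hconst
  have he0' : limsup (fun k => (e k : EReal)) atTop = 0 := by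
    have := (continuous_coe_real_ereal.tendsto 0).comp he0
    exact this.limsup_eq
  have hupp : limsup (fun k => (B k v v : EReal)) atTop ≤ Q v := by
    have hfun : (fun k => (B k v v : EReal)) =
        (fun k => (B k (u k) (u k) : EReal)) + fun k => (e k : EReal) := by
      ext k
      rw [Pi.add_apply, ← EReal.coe_add, ← hsplit]
    rw [hfun]
    refine (EReal.limsup_add_le ?_ ?_).trans ?_
    · right; rw [he0']; simp
    · right; rw [he0']; simp
    · rw [he0', add_zero]
      exact huQ
  have hlim := tendsto_of_le_liminf_of_limsup_le hlow hupp
  have hQ0 : 0 ≤ Q v := ge_of_tendsto' hlim fun k => EReal.coe_nonneg.2 (hnonneg k v)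
  have hQM : Q v ≤ (M : EReal) := le_of_tendsto' hlim fun k => EReal.coe_le_coe_iff.2 (hvM k)
  have hcoe : ((Q v).toReal : EReal) = Q v :=
    EReal.coe_toReal (ne_top_of_le_ne_top (EReal.coe_ne_top M) hQM)
      (ne_bot_of_le_ne_bot EReal.zero_ne_bot hQ0)
  refine ⟨(Q v).toReal, hcoe.symm, ?_⟩
  rw [← hcoe] at hlim
  exact EReal.tendsto_coe.1 hlim

/-- Symmetric bilinear forms that converge on the diagonal converge everywhere, by polarization,
and the limit is a symmetric bilinear form. -/
theorem exists_bilinForm_tendsto {E : Type*} [AddCommGroup E] [Module ℝ E]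
    {B : ℕ → LinearMap.BilinForm ℝ E} (hsymm : ∀ k, (B k).IsSymm)
    (h : ∀ v, ∃ q : ℝ, Tendsto (fun k => B k v v) atTop (𝓝 q)) :
    ∃ L : LinearMap.BilinForm ℝ E, L.IsSymm ∧
      ∀ u v, Tendsto (fun k => B k u v) atTop (𝓝 (L u v)) := by
  choose q hq using h
  have hlim : ∀ u v, Tendsto (fun k => B k u v) atTop (𝓝 ((q (u + v) - q u - q v) / 2)) := by
    intro u v
    refine ((((hq (u + v)).sub (hq u)).sub (hq v)).div_const 2).congr fun k => ?_
    rw [(hsymm k).polarization u v]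
  refine ⟨LinearMap.mk₂ ℝ (fun u v => (q (u + v) - q u - q v) / 2)
    (fun u u' v => tendsto_nhds_unique (hlim (u + u') v) ?_)
    (fun c u v => tendsto_nhds_unique (hlim (c • u) v) ?_)
    (fun u v v' => tendsto_nhds_unique (hlim u (v + v')) ?_)
    (fun c u v => tendsto_nhds_unique (hlim u (c • v)) ?_), ⟨fun u v => ?_⟩, hlim⟩
  · simpa using (hlim u v).add (hlim u' v)
  · simpa using (hlim u v).const_mul c
  · simpa using (hlim u v).add (hlim u v')
  · simpa using (hlim u v).const_mul c
  · exact tendsto_nhds_unique (hlim u v) ((hlim v u).congr fun k => (hsymm k).eq v u)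

/-! ### Locality -/

theorem discretize_eq_zero_of_disjoint_essSupport [BorelSpace X] [SecondCountableTopology X]
    {u : X → ℝ} {r : ℝ} {x : X} (h : Disjoint (Metric.ball x (r / 4)) (essSupport μ u)) :
    discretize μ r u x = 0 := by
  have hnull : (μ.restrict (Function.support u)) (Metric.ball x (r / 4)) = 0 :=
    measure_mono_null h.subset_compl_right Measure.measure_compl_support
  rw [Measure.restrict_apply Metric.isOpen_ball.measurableSet] at hnull
  rw [discretize, setAverage_eq]
  have : ∀ᵐ z ∂μ.restrict (Metric.ball x (r / 4)), u z = 0 := by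
    rw [ae_restrict_iff' Metric.isOpen_ball.measurableSet, ae_iff]
    convert! hnull using 2
    ext z
    simp
  rw [integral_eq_zero_of_ae this, smul_zero]

/-- An edge contributes only if one of the two balls over which the means are taken meets the
support. -/
theorem ball_subset_thickening_essSupport [BorelSpace X] [SecondCountableTopology X]
    {u : X → ℝ} {r : ℝ} {x y : X} (hr : 0 < r) (hxy : dist x y < 4 * r)
    (h : discretize μ r u y - discretize μ r u x ≠ 0) :
    Metric.ball x (5 * r) ⊆ Metric.thickening (10 * r) (essSupport μ u) := by
  have hw : ∃ w ∈ essSupport μ u, dist x w < 5 * r := by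
    by_contra! hcon
    have h0 : ∀ a, dist x a < 4 * r → discretize μ r u a = 0 := fun a ha => by
      refine discretize_eq_zero_of_disjoint_essSupport (disjoint_left.2 fun w hw hwu => ?_)
      rw [Metric.mem_ball'] at hw
      linarith [hcon w hwu, dist_triangle x a w]
    exact h (by rw [h0 y hxy, h0 x (by simpa using hr), sub_zero])
  obtain ⟨w, hwu, hxw⟩ := hw
  intro z hz
  rw [Metric.mem_ball] at hz
  exact Metric.mem_thickening_iff.2 ⟨w, hwu, by linarith [dist_triangle z x w]⟩

theorem eventually_notMem_thickening {X : Type*} [MetricSpace X] {E : Set X}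
    (hE : IsClosed E) {z : X} (hz : z ∉ E) {δ : ℕ → ℝ} (hδ : Tendsto δ atTop (𝓝 0)) :
    ∀ᶠ k in atTop, z ∉ Metric.thickening (δ k) E := by
  have hpos : 0 < Metric.infEDist z E := by
    rwa [pos_iff_ne_zero, Ne, ← Metric.mem_closure_iff_infEDist_zero, hE.closure_eq]
  have hlim : Tendsto (fun k => ENNReal.ofReal (δ k)) atTop (𝓝 0) := by
    simpa using ENNReal.tendsto_ofReal hδ
  filter_upwards [hlim.eventually_lt_const hpos] with k hk hmem
  exact lt_asymm hk (Metric.mem_thickening_iff_infEDist_lt.1 hmem)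

/-- The edges that contribute to `ℰ_r(u, v)` lie within `10r` of both supports. If these are
disjoint, such sets shrink to the empty set as `r → 0`, and the integrals over them that control
`ℰ_r(u, v)` vanish by dominated convergence. -/
theorem tendsto_approxForm_of_disjoint_essSupport [BorelSpace X] [IsLocallyFiniteMeasure μ]
    [μ.IsOpenPosMeasure] (hd : IsDoubling μ) (hP : SupportsPoincare μ) {net : ℝ → Set X}
    (hnet : ∀ r : ℝ, 0 < r → IsNet r (net r)) {r : ℕ → ℝ} (hr : ∀ k, 0 < r k)
    (hr0 : Tendsto r atTop (𝓝 0)) {u v : N12 μ}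
    (huv : Disjoint (essSupport μ u) (essSupport μ v)) :
    Tendsto (fun k => approxForm μ (net (r k)) (r k) u v) atTop (𝓝 0) := by
  have := hd.secondCountableTopology hnet
  obtain ⟨K, hK⟩ := exists_tsum_edgeTerm_le hd hP
  obtain ⟨g, h, hg, hh, hfin⟩ := N12.exists_upperGradient_pair u v
  set f : X → ℝ≥0∞ := fun z => g z ^ 2 + h z ^ 2 with hf
  have hfm : Measurable f := (hg.1.pow_const 2).add (hh.1.pow_const 2)
  set T : ℕ → Set X := fun k => Metric.thickening (10 * r k) (essSupport μ u) ∩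
    Metric.thickening (10 * r k) (essSupport μ v) with hT
  have hTm : ∀ k, MeasurableSet (T k) := fun k =>
    (Metric.isOpen_thickening.inter Metric.isOpen_thickening).measurableSet
  have hbound : ∀ k, ENNReal.ofReal |approxForm μ (net (r k)) (r k) u v| ≤
      K * ∫⁻ z in T k, f z ∂μ := fun k => by
    refine (ofReal_abs_tsum_le (summable_edgeTerm hd hP (hr k) (hnet _ (hr k)) u v)).trans
      (hK _ _ u v g h (T k) (hr k) (hnet _ (hr k)) u.2.1 v.2.1 hg hh (hTm k)
        fun x _ y _ hxy hne => ?_)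
    refine subset_inter (ball_subset_thickening_essSupport (hr k) hxy fun h0 => hne ?_)
      (ball_subset_thickening_essSupport (hr k) hxy fun h0 => hne ?_) <;>
    simp [edgeTerm, h0]
  have hδ : Tendsto (fun k => 10 * r k) atTop (𝓝 0) := by simpa using hr0.const_mul 10
  have hint : Tendsto (fun k => ∫⁻ z in T k, f z ∂μ) atTop (𝓝 0) := by
    simp_rw [← lintegral_indicator (hTm _)]
    rw [← lintegral_zero (μ := μ)]
    refine tendsto_lintegral_of_dominated_convergence f (fun k => hfm.indicator (hTm k))
      (fun k => ae_of_all _ fun z => indicator_le_self _ _ z) hfin (ae_of_all _ fun z => ?_)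
    have hz : ∀ᶠ k in atTop, z ∉ T k := by
      by_cases hzu : z ∈ essSupport μ u
      · filter_upwards [eventually_notMem_thickening Measure.isClosed_support
          (disjoint_left.1 huv hzu) hδ] with k hk hmem using hk hmem.2
      · filter_upwards [eventually_notMem_thickening Measure.isClosed_support hzu hδ]
          with k hk hmem using hk hmem.1
    exact tendsto_const_nhds.congr' (hz.mono fun k hk => (indicator_of_notMem hk f).symm)
  have hlim : Tendsto (fun k => ENNReal.ofReal |approxForm μ (net (r k)) (r k) u v|) atTop
      (𝓝 0) := by
    refine tendsto_of_tendsto_of_tendsto_of_le_of_le tendsto_const_nhds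
      (?_ : Tendsto (fun k => K * ∫⁻ z in T k, f z ∂μ) atTop (𝓝 0)) (fun _ => zero_le) hbound
    simpa using ENNReal.Tendsto.const_mul (a := (K : ℝ≥0∞)) hint (Or.inr ENNReal.coe_ne_top)
  have habs := (ENNReal.tendsto_toReal ENNReal.zero_ne_top).comp hlim
  rw [tendsto_zero_iff_abs_tendsto_zero]
  simpa [Function.comp_def, ENNReal.toReal_ofReal (abs_nonneg _)] using habs

end GraphForm

theorem mainTheorem3 {X : Type*} [MetricSpace X] [CompleteSpace X] [MeasurableSpace X]
    [BorelSpace X] (μ : Measure X) [IsLocallyFiniteMeasure μ] [μ.IsOpenPosMeasure]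
    (hgeo : GraphForm.IsGeodesicSpace X) (hdoub : GraphForm.IsDoubling μ)
    (hPI : GraphForm.SupportsPoincare μ)
    (net : ℝ → Set X) (hnet : ∀ r : ℝ, 0 < r → GraphForm.IsNet r (net r)) :
    (∀ r : ℝ, 0 < r → ∀ u v : GraphForm.N12 μ,
      Summable fun p : (x : net r) × (GraphForm.netGraph (net r) r).neighborSet x =>
        GraphForm.edgeTerm μ r u v (p.1 : X) (p.2.1 : X)) ∧
    ∀ (r : ℕ → ℝ), (∀ k, 0 < r k) → Tendsto r atTop (𝓝 0) →
    ∀ Q : GraphForm.N12 μ → EReal,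
      GraphForm.IsGammaLimit
        (fun k u => GraphForm.approxForm μ (net (r k)) (r k) u u) Q →
      ∃ ℰ : LinearMap.BilinForm ℝ (GraphForm.N12 μ),
        ℰ.IsSymm ∧
        (∀ u, Q u = (ℰ u u : ℝ)) ∧
        (∀ u v : GraphForm.N12 μ,
          Disjoint (GraphForm.essSupport μ u) (GraphForm.essSupport μ v) → ℰ u v = 0) ∧
        ∀ u : GraphForm.N12 μ,
          Tendsto (fun k => GraphForm.approxForm μ (net (r k)) (r k) u u) atTop (𝓝 (ℰ u u)) := by
  refine ⟨fun r hr u v => GraphForm.summable_edgeTerm hdoub hPI hr (hnet r hr) u v,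
    fun r hr hr0 Q hQ => ?_⟩
  have hS : ∀ k, GraphForm.IsNet (r k) (net (r k)) := fun k => hnet _ (hr k)
  have hsymm := fun k => GraphForm.approxBilin_isSymm hdoub hPI (hr k) (hS k)
  obtain ⟨K, hK⟩ := GraphForm.exists_approxForm_self_le hdoub hPI
  have hlim := fun v => GraphForm.IsGammaLimit.exists_tendsto hsymm
    (fun k u => GraphForm.approxForm_self_nonneg _ _ _)
    (fun k u => hK (r k) (net (r k)) u (hr k) (hS k)) hQ v
  obtain ⟨ℰ, hℰ, hℰlim⟩ := GraphForm.exists_bilinForm_tendsto hsymm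
    fun v => (hlim v).imp fun _ h => h.2
  refine ⟨ℰ, hℰ, fun u => ?_, fun u v huv => ?_, fun u => hℰlim u u⟩
  · obtain ⟨q, hQq, hq⟩ := hlim u
    rw [hQq, tendsto_nhds_unique hq (hℰlim u u)]
  · exact tendsto_nhds_unique (hℰlim u v)
      (GraphForm.tendsto_approxForm_of_disjoint_essSupport hdoub hPI hnet hr hr0 huv)
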